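/- Let $m\le n$, $A\in\mathbb R^{m\times n}$, $L\in\mathbb R^{p\times n}$ with $\operatorname{rank}[A^T,L^T]^T=n$, ${\bf b}\in\mathbb R^m$, let $\bar\sigma_1\ge\dots\ge\bar\sigma_m\ge 0$ be the singular values of $A$, and let $\|\cdot\|$ be the Euclidean or spectral norm and $\dagger$ the Moore–Penrose inverse. Let $U^TAX=\Sigma_A$, $V^TLX=\Sigma_L$ be a generalized singular value decomposition of $\{A,L\}$, with $U,V$ orthogonal, $X$ nonsingular, nonzero parts $\operatorname{diag}(\alpha_i)$ of $\Sigma_A$ (lower right corner) and $\operatorname{diag}(\beta_i)$ of $\Sigma_L$ (upper left corner), $0\le\alpha_1\le\dots\le\alpha_n\le 1$, $\beta_i\ge0$, $\alpha_i^2+\beta_i^2=1$. Let $\epsilon>0$, $\lambda>0$, and suppose that for some target rank $0\le k<m$ and real constants $\bar c_1,\bar c_2,K_1,K_2$ $$|\epsilon-\bar c_1\bar\sigma_{k+1}|\le K_1\bar\sigma_{k+1}^2,\qquad |\lambda-\bar c_2\bar\sigma_{k+1}|\le K_2\bar\sigma_{k+1}^2 .$$ Let ${\bf x}_\lambda\neq{\bf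 0}$ be the minimizer of $\|A{\bf x}-{\bf b}\|^2+\lambda^2\|L{\bf x}\|^2$. For a matrix $B$ with $N$ columns and a random $N\times N$ test matrix $\Omega$ with independent entries that are uniform on $[-\sqrt3,\sqrt3]$, a range finder output for $B$ with tolerance $\epsilon$ is a matrix $Q$ with $\ell\le N$ orthonormal columns such that $B\,\Omega(:,1:\ell)=QR$ with $R$ upper triangular with nonzero diagonal, and $\|B-QQ^TB\|\le\epsilon$. In the two-sided randomized algorithm for $m\le n$, $Q\in\mathbb R^{n\times\ell_1}$ is a range finder output for $A^T$ with test matrix $\Omega_Q$, and then $P\in\mathbb R^{m\times\ell_2}$ is a range finder output for $AQ$ with a fresh test matrix $\Omega_P$, both with tolerance $\epsilon$. Put $$\mathcal A=\begin{bmatrix}A\\ \lambda L\end{bmatrix},\quad \tilde{\mathcal A}=\begin{bmatrix}PP^TA\\ \lambda L\end{bmatrix},\quad \tilde{\mathcal A}QQ^T=\begin{bmatrix}PP^TAQQ^T\\ \lambda LQQ^T\end{bmatrix},$$ and let ${\bf x}_\lambda^R$ be the minimum-norm least-squares solution of $\min_{\bf x}\|\tilde{\mathcal A}QQ^T{\bf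 x}-[{\bf b}^T,{\bf 0}^T]^T\|$. Let $c=(1+\sqrt5)/2$, $\tilde\nu_\lambda=\|{\bf b}\|/\|{\bf x}_\lambda\|$, $\nu_\lambda=\|\mathcal A^\dagger\|\tilde\nu_\lambda$, $\kappa(\mathcal A)=\|\mathcal A\|\|\mathcal A^\dagger\|$, $\gamma_1=\|L(QQ^T-I)\|$, $\gamma_2=\|X^{-1}\|\sqrt{\|X\|^2+\bar c_2^2}$. Then, with probability one over $\Omega_Q$ and then over $\Omega_P$, for all such $Q$ and $P$: if $n\le \ell_2+\operatorname{rank}L$, then $\tilde{\mathcal A}$ has full column rank $n$; and $$\frac{\|{\bf x}_\lambda^R-{\bf x}_\lambda\|}{\|{\bf x}_\lambda\|}\le \|\mathcal A^\dagger\|\Big(c\bar c_1(\xi\tilde\nu_\lambda+\nu_\lambda)+c\bar c_2\gamma_1\nu_\lambda+(1+c\,\kappa(\mathcal A)\nu_\lambda)\gamma_2\Big)\bar\sigma_{k+1}+\|\mathcal A^\dagger\|\Big(cK_1(\xi\tilde\nu_\lambda+\nu_\lambda)+cK_2\gamma_1\nu_\lambda\Big)\bar\sigma_{k+1}^2$$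 holds with $\xi=\|(\tilde{\mathcal A}QQ^T)^\dagger\|$, and also with $\xi=\|\tilde{\mathcal A}^\dagger\|$ whenever $\tilde{\mathcal A}$ has full column rank $n$. -/

import Mathlib

open MeasureTheory ProbabilityTheory
open scoped Matrix Matrix.Norms.L2Operator

/-! Conventions: vectors of `ℝⁿ` live in `EuclideanSpace ℝ (Fin n)`; the norm `‖M‖` of a matrix is the
spectral norm (operator norm for the Euclidean norms). -/

section PseudoInverse

variable {ι κ : Type*} [Fintype ι] [Fintype κ] [DecidableEq κ]

/-- `N` is the Moore–Penrose inverse of the real matrix `M`: the four Penrose equations. -/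
structure IsMoorePenrose (M : Matrix ι κ ℝ) (N : Matrix κ ι ℝ) : Prop where
  mul_mul_self : M * N * M = M
  self_mul_mul : N * M * N = N
  symm_left : (M * N)ᵀ = M * N
  symm_right : (N * M)ᵀ = N * M

/-- Every real matrix has a Moore–Penrose inverse. -/
theorem exists_isMoorePenrose (M : Matrix ι κ ℝ) : ∃ N, IsMoorePenrose M N := by
  have hH : (Mᵀ * M).IsHermitian := by
    have h := Matrix.isHermitian_conjTranspose_mul_self M
    rwa [Matrix.conjTranspose_eq_transpose_of_trivial] at h
  set U : Matrix κ κ ℝ := (hH.eigenvectorUnitary : Matrix κ κ ℝ) with hU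
  set d : κ → ℝ := hH.eigenvalues with hd
  have hUU : Uᵀ * U = 1 := by
    have h := (Matrix.mem_unitaryGroup_iff').1 hH.eigenvectorUnitary.2
    rwa [Matrix.star_eq_conjTranspose, Matrix.conjTranspose_eq_transpose_of_trivial] at h
  have hspec : Mᵀ * M = U * Matrix.diagonal d * Uᵀ := by
    have h := hH.spectral_theorem
    rw [Unitary.conjStarAlgAut_apply] at h
    have e : (RCLike.ofReal ∘ hH.eigenvalues : κ → ℝ) = d := by
      funext i; simp [hd]
    rw [e, Matrix.star_eq_conjTranspose,
      Matrix.conjTranspose_eq_transpose_of_trivial] at h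
    exact h
  set H : Matrix κ κ ℝ := Mᵀ * M with hHdef
  set G : Matrix κ κ ℝ := U * Matrix.diagonal (fun i => (d i)⁻¹) * Uᵀ with hG
  have hmul : ∀ a b : κ → ℝ, (U * Matrix.diagonal a * Uᵀ) * (U * Matrix.diagonal b * Uᵀ)
      = U * Matrix.diagonal (fun i => a i * b i) * Uᵀ := by
    intro a b
    calc (U * Matrix.diagonal a * Uᵀ) * (U * Matrix.diagonal b * Uᵀ)
        = U * Matrix.diagonal a * (Uᵀ * U) * Matrix.diagonal b * Uᵀ := by
          simp only [Matrix.mul_assoc]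
      _ = _ := by
          rw [hUU, Matrix.mul_one, Matrix.mul_assoc U, Matrix.diagonal_mul_diagonal]
  have htr : ∀ a : κ → ℝ, (U * Matrix.diagonal a * Uᵀ)ᵀ = U * Matrix.diagonal a * Uᵀ := by
    intro a
    simp [Matrix.transpose_mul, Matrix.mul_assoc]
  have hGT : Gᵀ = G := htr _
  have hHT : Hᵀ = H := by rw [hspec]; exact htr _
  have hGHT : (G * H)ᵀ = G * H := by rw [hspec, hG, hmul]; exact htr _
  have hHGH : H * (G * H) = H := by
    rw [hspec, hG, hmul, hmul]
    congr 3
    funext i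
    by_cases h : d i = 0
    · simp [h]
    · field_simp
  have hGHG : G * H * G = G := by
    rw [hspec, hG, hmul, hmul]
    congr 3
    funext i
    by_cases h : d i = 0
    · simp [h]
    · field_simp
  have hM : M * (G * H) = M := by
    have h0 : (M * (G * H) - M)ᵀ * (M * (G * H) - M) = 0 := by
      have e : (M * (G * H) - M)ᵀ = (G * H - 1) * Mᵀ := by
        rw [Matrix.transpose_sub, Matrix.transpose_mul, hGHT, Matrix.sub_mul, Matrix.one_mul]
      have e2 : M * (G * H) - M = M * (G * H - 1) := by
        rw [Matrix.mul_sub, Matrix.mul_one]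
      rw [e, e2, Matrix.mul_assoc, ← Matrix.mul_assoc Mᵀ M, ← hHdef, Matrix.mul_sub,
        hHGH, Matrix.mul_one, sub_self, Matrix.mul_zero]
    have h1 : M * (G * H) - M = 0 := by
      rw [← Matrix.conjTranspose_mul_self_eq_zero, Matrix.conjTranspose_eq_transpose_of_trivial]
      exact h0
    exact sub_eq_zero.1 h1
  refine ⟨G * Mᵀ, ?_, ?_, ?_, ?_⟩
  · rw [Matrix.mul_assoc, Matrix.mul_assoc G, ← hHdef, hM]
  · rw [Matrix.mul_assoc G Mᵀ M, ← hHdef, ← Matrix.mul_assoc, hGHG]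
  · rw [Matrix.transpose_mul, Matrix.transpose_mul, hGT, Matrix.transpose_transpose,
      Matrix.mul_assoc]
  · rw [Matrix.mul_assoc, ← hHdef, hGHT]

/-- The Moore–Penrose inverse `M†`. -/
noncomputable def pinv (M : Matrix ι κ ℝ) : Matrix κ ι ℝ :=
  (exists_isMoorePenrose M).choose

theorem isMoorePenrose_pinv (M : Matrix ι κ ℝ) : IsMoorePenrose M (pinv M) :=
  (exists_isMoorePenrose M).choose_spec

/-- `x` is the least-squares solution of `min ‖M x - y‖` of minimum Euclidean norm. -/
def IsMinNormLeastSquares (M : Matrix ι κ ℝ) (y : EuclideanSpace ℝ ι)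
    (x : EuclideanSpace ℝ κ) : Prop :=
  (∀ z, ‖Matrix.toEuclideanLin M x - y‖ ≤ ‖Matrix.toEuclideanLin M z - y‖) ∧
  ∀ z, (∀ w, ‖Matrix.toEuclideanLin M z - y‖ ≤ ‖Matrix.toEuclideanLin M w - y‖) → ‖x‖ ≤ ‖z‖

end PseudoInverse

/-- `{A, L}` is a Grassman matrix pair: `rank [Aᵀ, Lᵀ]ᵀ = n`. -/
def IsGMP {m p n : ℕ} (A : Matrix (Fin m) (Fin n) ℝ) (L : Matrix (Fin p) (Fin n) ℝ) : Prop :=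
  (Matrix.fromRows A L).rank = n

/-- `x` solves the Tikhonov problem `min ‖A x - b‖² + lam² ‖L x‖²`. -/
def IsTikhonovSolution {m p n : ℕ} (A : Matrix (Fin m) (Fin n) ℝ) (L : Matrix (Fin p) (Fin n) ℝ)
    (lam : ℝ) (b : EuclideanSpace ℝ (Fin m)) (x : EuclideanSpace ℝ (Fin n)) : Prop :=
  ∀ z, ‖Matrix.toEuclideanLin A x - b‖ ^ 2 + lam ^ 2 * ‖Matrix.toEuclideanLin L x‖ ^ 2
    ≤ ‖Matrix.toEuclideanLin A z - b‖ ^ 2 + lam ^ 2 * ‖Matrix.toEuclideanLin L z‖ ^ 2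

/-- The stacked right-hand side `[bᵀ, 0ᵀ]ᵀ`. -/
def stackedRhs {m : ℕ} (p : ℕ) (b : EuclideanSpace ℝ (Fin m)) :
    EuclideanSpace ℝ (Fin m ⊕ Fin p) :=
  WithLp.toLp 2 (Sum.elim (fun i => b i) (fun _ => 0))

/-- The `(k+1)`-st largest singular value of `A` (index `k` counted from `0`). -/
noncomputable def sval {m n : ℕ} (A : Matrix (Fin m) (Fin n) ℝ) (k : ℕ) : ℝ :=
  (Matrix.toEuclideanLin A).singularValues k

/-- The generalized singular value decomposition of the pair `{A, L}`:
`Uᵀ A X = [0 0; 0 D₁]` with `D₁` in the lower right corner and `Vᵀ L X = [D₂ 0; 0 0]` with `D₂` in the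
upper left corner, the generalized singular values `α i / β i` being in nondecreasing order.
`D₁` holds the nonzero `α i` and `D₂` the nonzero `β i`; the block sizes are the numbers of the `α i`
that are `0`, strictly between `0` and `1`, and `1`. -/
structure IsGSVD {m p n : ℕ} (A : Matrix (Fin m) (Fin n) ℝ) (L : Matrix (Fin p) (Fin n) ℝ)
    (U : Matrix (Fin m) (Fin m) ℝ) (V : Matrix (Fin p) (Fin p) ℝ) (X : Matrix (Fin n) (Fin n) ℝ)
    (α β : Fin n → ℝ) : Prop where
  orthU : Uᵀ * U = 1
  orthV : Vᵀ * V = 1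
  nonsingular : IsUnit X.det
  α_nonneg : ∀ j, 0 ≤ α j
  β_nonneg : ∀ j, 0 ≤ β j
  sq_add_sq : ∀ j, α j ^ 2 + β j ^ 2 = 1
  α_mono : Monotone α
  α_zero : ∀ j : Fin n, (j : ℕ) + m < n → α j = 0
  β_zero : ∀ j : Fin n, p ≤ (j : ℕ) → β j = 0
  eqA : Uᵀ * A * X = Matrix.of fun (i : Fin m) (j : Fin n) =>
    if (i : ℕ) + n = (j : ℕ) + m then α j else 0
  eqL : Vᵀ * L * X = Matrix.of fun (i : Fin p) (j : Fin n) =>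
    if (i : ℕ) = (j : ℕ) then β j else 0

/-- The law of an `N × ℓ` uniform random matrix: the entries are independent and uniformly
distributed on `[-√3, √3]`. -/
noncomputable def uniformMatrixLaw (N ℓ : ℕ) : Measure (Fin N → Fin ℓ → ℝ) :=
  Measure.pi fun _ => Measure.pi fun _ => (volume : Measure ℝ)[|Set.Icc (-√3) √3]

/-- `Q` (with `ℓ` columns) is an approximate basis matrix for the range of `B`, computed from the
random test matrix `Ω` within the tolerance `ε`: `Q` has orthonormal columns, it is the factor of a
reduced QR decomposition of `B` times the first `ℓ` columns of `Ω`, and `‖B - Q Qᵀ B‖ ≤ ε`.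

`Ω` collects all the blocks of columns that the blockwise adaptive range finder may draw. That
algorithm orthogonalizes the columns of `B Ω` one after the other, in blocks of any size, keeps those
whose diagonal entry in `R` exceeds `ε`, and stops at the first other one; so what it keeps has the form
described here, whatever the block size, and the stopping rule only selects the number `ℓ`. -/
def IsRangeFinderOutput {M N ℓ : ℕ} (B : Matrix (Fin M) (Fin N) ℝ) (ε : ℝ)
    (Ω : Fin N → Fin N → ℝ) (Q : Matrix (Fin M) (Fin ℓ) ℝ) : Prop :=
  Qᵀ * Q = 1 ∧
  (∃ (h : ℓ ≤ N) (R : Matrix (Fin ℓ) (Fin ℓ) ℝ),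
    (∀ i j, j < i → R i j = 0) ∧ (∀ j, R j j ≠ 0) ∧
    B * (Matrix.of Ω).submatrix id (Fin.castLE h) = Q * R) ∧
  ‖B - Q * Qᵀ * B‖ ≤ ε

/-! With `T = Q Qᵀ`, the Tikhonov solution is `𝒜† [b; 0]` and the randomized one is `𝒜R† [b; 0]`,
where `𝒜R T = 𝒜R`, hence `T 𝒜R† = 𝒜R†`. Since `𝒜† 𝒜 = 1`,
`𝒜† - 𝒜R† = 𝒜† (𝒜R - 𝒜 T) 𝒜R† + 𝒜† (1 - 𝒜R 𝒜R†)`.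
The two summands have orthogonal row spaces, so their norms add in squares, and this is where the
factor `√2 ≤ (1 + √5) / 2` comes from. The first is at most `‖𝒜†‖ ε ‖𝒜R†‖`, because `P` captures the
range of `A Q` up to `ε`. The second is at most `‖𝒜†‖² ‖𝒜 - 𝒜R‖`, and `𝒜 - 𝒜R` splits into
`𝒜 (1 - T)`, controlled by the range finder for `Aᵀ` and by `γ₁`, and `𝒜 T - 𝒜R`, again with
orthogonal row spaces.

For the rank claim let the columns of `W` be a basis of `ker L`; `P Pᵀ A` and `L` have a common
nonzero null vector exactly when `P Pᵀ A W` is not injective. As `Q` and `P` differ from the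
sketches `Aᵀ ΩQ` and `A Q ΩP` by triangular factors, it is enough that a random `Ω` almost surely
keeps `Ωᵀ G` injective for an injective `G`. The determinant of a maximal square block of `Ωᵀ G` is
a polynomial in `Ω`; it does not vanish when the leading columns of `Ω` are those of `G`, so it
vanishes only on a null set.
-/

section SpectralNorm

variable {𝕜 ι ι' κ : Type*} [RCLike 𝕜] [Fintype ι] [Fintype ι'] [Fintype κ] [DecidableEq κ]

theorem norm_add_sq_le_of_mul_conjTranspose_eq_zero {A B : Matrix ι κ 𝕜} (h : A * Bᴴ = 0) :
    ‖A + B‖ ^ 2 ≤ ‖A‖ ^ 2 + ‖B‖ ^ 2 := by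
  classical
  have norm_mul_conjTranspose (C : Matrix ι κ 𝕜) : ‖C * Cᴴ‖ = ‖C‖ ^ 2 := by
    simpa [sq, Matrix.l2_opNorm_conjTranspose] using Cᴴ.l2_opNorm_conjTranspose_mul_self
  have h' : B * Aᴴ = 0 := by simpa using congrArg Matrix.conjTranspose h
  calc ‖A + B‖ ^ 2 = ‖A * Aᴴ + B * Bᴴ‖ := by
        rw [← norm_mul_conjTranspose, Matrix.conjTranspose_add, Matrix.add_mul, Matrix.mul_add,
          Matrix.mul_add, h, h', add_zero, zero_add]
    _ ≤ ‖A * Aᴴ‖ + ‖B * Bᴴ‖ := norm_add_le _ _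
    _ = ‖A‖ ^ 2 + ‖B‖ ^ 2 := by rw [norm_mul_conjTranspose, norm_mul_conjTranspose]

theorem norm_fromRows_le (A : Matrix ι κ 𝕜) (B : Matrix ι' κ 𝕜) :
    ‖Matrix.fromRows A B‖ ≤ ‖A‖ + ‖B‖ := by
  have h : ‖Matrix.fromRows A B‖ ^ 2 ≤ ‖A‖ ^ 2 + ‖B‖ ^ 2 := by
    simp only [sq, ← Matrix.l2_opNorm_conjTranspose_mul_self,
      Matrix.conjTranspose_fromRows_eq_fromCols_conjTranspose, Matrix.fromCols_mul_fromRows]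
    exact norm_add_le _ _
  nlinarith [norm_nonneg A, norm_nonneg B]

theorem norm_toEuclideanLin_le (A : Matrix ι κ 𝕜) (x : EuclideanSpace 𝕜 κ) :
    ‖A.toEuclideanLin x‖ ≤ ‖A‖ * ‖x‖ :=
  A.l2_opNorm_mulVec x

theorem norm_le_one_of_conjTranspose_mul_self_eq_one {Q : Matrix ι κ 𝕜} (hQ : Qᴴ * Q = 1) :
    ‖Q‖ ≤ 1 := by
  have h := Q.l2_opNorm_conjTranspose_mul_self
  have h1 : ‖(1 : Matrix κ κ 𝕜)‖ ≤ 1 := IsStarProjection.norm_le 1 (.one _)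
  nlinarith [norm_nonneg Q, hQ ▸ h]

theorem isStarProjection_mul_transpose {Q : Matrix ι κ ℝ} (hQ : Qᵀ * Q = 1) :
    IsStarProjection (Q * Qᵀ) where
  isIdempotentElem := by
    rw [IsIdempotentElem, Matrix.mul_assoc, ← Matrix.mul_assoc Qᵀ, hQ, Matrix.one_mul]
  isSelfAdjoint := by
    rw [IsSelfAdjoint, Matrix.star_eq_conjTranspose, Matrix.conjTranspose_eq_transpose_of_trivial,
      Matrix.transpose_mul, Matrix.transpose_transpose]

end SpectralNorm

namespace IsMoorePenrose

section Algebra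

variable {ι κ : Type*} [Fintype ι] [Fintype κ] {M : Matrix ι κ ℝ} {N : Matrix κ ι ℝ}

theorem symm (h : IsMoorePenrose M N) : IsMoorePenrose N M :=
  ⟨h.self_mul_mul, h.mul_mul_self, h.symm_right, h.symm_left⟩

theorem isStarProjection (h : IsMoorePenrose M N) : IsStarProjection (M * N) where
  isIdempotentElem := by rw [IsIdempotentElem, ← Matrix.mul_assoc, h.mul_mul_self]
  isSelfAdjoint := by
    rw [IsSelfAdjoint, Matrix.star_eq_conjTranspose, Matrix.conjTranspose_eq_transpose_of_trivial,
      h.symm_left]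

theorem mul_eq_one_of_injective [DecidableEq κ] (h : IsMoorePenrose M N)
    (hM : Function.Injective M.mulVec) : N * M = 1 := by
  refine Matrix.ext_of_mulVec_single fun i => hM ?_
  rw [Matrix.mulVec_mulVec, Matrix.mulVec_mulVec, ← Matrix.mul_assoc, h.mul_mul_self,
    Matrix.mul_one]

theorem mul_eq_of_mul_eq (h : IsMoorePenrose M N) {T : Matrix κ κ ℝ} (hT : IsSelfAdjoint T)
    (hMT : M * T = M) : T * N = N := by
  have hTt : Tᵀ = T := by
    rwa [IsSelfAdjoint, Matrix.star_eq_conjTranspose,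
      Matrix.conjTranspose_eq_transpose_of_trivial] at hT
  have hN : Mᵀ * Nᵀ * N = N := by rw [← Matrix.transpose_mul, h.symm_right, h.self_mul_mul]
  have hTM : T * Mᵀ = Mᵀ := by rw [← hTt, ← Matrix.transpose_mul, hMT]
  rw [← hN, ← Matrix.mul_assoc, ← Matrix.mul_assoc, hTM]

end Algebra

section Norm

variable {ι κ : Type*} [Fintype ι] [Fintype κ] [DecidableEq ι] [DecidableEq κ]
  {M B : Matrix ι κ ℝ} {N C : Matrix κ ι ℝ} {T : Matrix κ κ ℝ}

theorem norm_le_of_mul_projection (hC : IsMoorePenrose (M * T) C) (hNM : N * M = 1)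
    (hT : IsStarProjection T) : ‖C‖ ≤ ‖N‖ := by
  have hTC : T * C = C := hC.mul_eq_of_mul_eq hT.isSelfAdjoint <| by
    rw [Matrix.mul_assoc, hT.isIdempotentElem.eq]
  calc ‖C‖ = ‖N * (M * T * C)‖ := by
        rw [Matrix.mul_assoc M, hTC, ← Matrix.mul_assoc, hNM, Matrix.one_mul]
    _ ≤ ‖N‖ * ‖M * T * C‖ := Matrix.l2_opNorm_mul _ _
    _ ≤ ‖N‖ := mul_le_of_le_one_right (norm_nonneg _) hC.isStarProjection.norm_le

theorem norm_mul_one_sub_le (hM : IsMoorePenrose M N) (hB : IsMoorePenrose B C) :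
    ‖N * (1 - B * C)‖ ≤ ‖N‖ ^ 2 * ‖M - B‖ := by
  have hfactor : (1 - B * C) * (M * N) = (1 - B * C) * (M - B) * N := by
    have : (1 - B * C) * B = 0 := by
      rw [Matrix.sub_mul, Matrix.one_mul, hB.mul_mul_self, sub_self]
    rw [Matrix.mul_sub, this, sub_zero, Matrix.mul_assoc]
  have hadjoint : M * N * (1 - B * C) = ((1 - B * C) * (M * N))ᴴ := by
    rw [Matrix.conjTranspose_mul, ← Matrix.star_eq_conjTranspose, ← Matrix.star_eq_conjTranspose,
      hM.isStarProjection.isSelfAdjoint.star_eq,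
      hB.isStarProjection.one_sub.isSelfAdjoint.star_eq]
  calc ‖N * (1 - B * C)‖ = ‖N * (M * N * (1 - B * C))‖ := by
        rw [← Matrix.mul_assoc, ← Matrix.mul_assoc, hM.self_mul_mul]
    _ ≤ ‖N‖ * ‖M * N * (1 - B * C)‖ := Matrix.l2_opNorm_mul _ _
    _ = ‖N‖ * ‖(1 - B * C) * (M - B) * N‖ := by
        rw [hadjoint, Matrix.l2_opNorm_conjTranspose, hfactor]
    _ ≤ ‖N‖ * (1 * ‖M - B‖ * ‖N‖) := by
        gcongr
        refine (Matrix.l2_opNorm_mul _ _).trans ?_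
        gcongr
        refine (Matrix.l2_opNorm_mul _ _).trans ?_
        gcongr
        exact hB.isStarProjection.one_sub.norm_le
    _ = ‖N‖ ^ 2 * ‖M - B‖ := by ring

theorem norm_sub_sq_le (hM : IsMoorePenrose M N) (hB : IsMoorePenrose B C) (hNM : N * M = 1) :
    ‖N - C‖ ^ 2 ≤ ‖N * (B - M) * C‖ ^ 2 + (‖N‖ ^ 2 * ‖M - B‖) ^ 2 := by
  have hdecomp : N - C = N * (B - M) * C + N * (1 - B * C) := by
    rw [Matrix.mul_sub, Matrix.sub_mul, hNM, Matrix.one_mul, Matrix.mul_sub, Matrix.mul_one,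
      Matrix.mul_assoc]
    abel
  have horth : N * (B - M) * C * (N * (1 - B * C))ᴴ = 0 := by
    have hC : C * (1 - B * C) = 0 := by
      rw [Matrix.mul_sub, Matrix.mul_one, ← Matrix.mul_assoc, hB.self_mul_mul, sub_self]
    rw [Matrix.conjTranspose_mul, ← Matrix.star_eq_conjTranspose (1 - B * C),
      hB.isStarProjection.one_sub.isSelfAdjoint.star_eq, Matrix.mul_assoc _ C,
      ← Matrix.mul_assoc C, hC, Matrix.zero_mul, Matrix.mul_zero]
  rw [hdecomp]
  refine (norm_add_sq_le_of_mul_conjTranspose_eq_zero horth).trans ?_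
  gcongr
  exact hM.norm_mul_one_sub_le hB

theorem norm_sub_le_of_mul_projection (hM : IsMoorePenrose M N) (hB : IsMoorePenrose B C)
    (hNM : N * M = 1) (hT : IsStarProjection T) (hBT : B * T = B) {ε δ : ℝ}
    (hε : ‖B - M * T‖ ≤ ε) (hδ : ‖M - M * T‖ ≤ δ) (hεδ : ε ≤ δ) :
    ‖C - N‖ ≤ √2 * ‖N‖ * (‖C‖ * ε + ‖N‖ * δ) := by
  have hε0 : 0 ≤ ε := (norm_nonneg _).trans hε
  have hfirst : ‖N * (B - M) * C‖ ≤ ‖N‖ * ε * ‖C‖ := by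
    have hTC : T * C = C := hB.mul_eq_of_mul_eq hT.isSelfAdjoint hBT
    have hfactor : N * (B - M) * C = N * (B - M * T) * C := by
      rw [Matrix.mul_assoc, Matrix.mul_assoc, Matrix.sub_mul, Matrix.sub_mul, Matrix.mul_assoc M,
        hTC]
    rw [hfactor]
    refine (Matrix.l2_opNorm_mul _ _).trans ?_
    gcongr
    exact (Matrix.l2_opNorm_mul _ _).trans (by gcongr)
  have hsecond : ‖M - B‖ ^ 2 ≤ δ ^ 2 + ε ^ 2 := by
    have horth : (M - M * T) * (M * T - B)ᴴ = 0 := by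
      have hfactor : M * T - B = (M * T - B) * T := by
        rw [Matrix.sub_mul, hBT, Matrix.mul_assoc, hT.isIdempotentElem.eq]
      rw [hfactor, Matrix.conjTranspose_mul, ← Matrix.star_eq_conjTranspose T,
        hT.isSelfAdjoint.star_eq, ← Matrix.mul_assoc, Matrix.sub_mul, Matrix.mul_assoc M,
        hT.isIdempotentElem.eq, sub_self, Matrix.zero_mul]
    have hpyth := norm_add_sq_le_of_mul_conjTranspose_eq_zero horth
    rw [sub_add_sub_cancel, norm_sub_rev (M * T)] at hpyth
    exact hpyth.trans (by gcongr)
  have hsq : ‖C - N‖ ^ 2 ≤ (√2 * ‖N‖ * (‖C‖ * ε + ‖N‖ * δ)) ^ 2 :=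
    calc ‖C - N‖ ^ 2 ≤ ‖N * (B - M) * C‖ ^ 2 + ‖N‖ ^ 4 * ‖M - B‖ ^ 2 := by
          rw [norm_sub_rev]
          exact (hM.norm_sub_sq_le hB hNM).trans_eq (by ring)
      _ ≤ (‖N‖ * ε * ‖C‖) ^ 2 + ‖N‖ ^ 4 * (δ ^ 2 + δ ^ 2) := by
          gcongr
          exact hsecond.trans (by gcongr)
      _ ≤ 2 * (‖N‖ * (‖C‖ * ε + ‖N‖ * δ)) ^ 2 := by
          have hcross : 0 ≤ ‖N‖ ^ 2 * (‖C‖ * ε) * (‖C‖ * ε + 4 * ‖N‖ * δ) := by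
            have := hε0.trans hεδ
            positivity
          linarith
      _ = (√2 * ‖N‖ * (‖C‖ * ε + ‖N‖ * δ)) ^ 2 := by
          rw [mul_assoc √2, mul_pow √2, Real.sq_sqrt zero_le_two]
  refine le_of_sq_le_sq hsq ?_
  have := hε0.trans hεδ
  positivity

end Norm

end IsMoorePenrose

section LeastSquares

variable {ι κ : Type*} [Fintype ι] [Fintype κ] [DecidableEq ι] [DecidableEq κ]
  {M : Matrix ι κ ℝ} {N : Matrix κ ι ℝ}

namespace IsMoorePenrose

theorem norm_toEuclideanLin_sub_sq (h : IsMoorePenrose M N) (z : EuclideanSpace ℝ κ)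
    (v : EuclideanSpace ℝ ι) :
    ‖M.toEuclideanLin z - v‖ ^ 2 =
      ‖M.toEuclideanLin (z - N.toEuclideanLin v)‖ ^ 2
        + ‖M.toEuclideanLin (N.toEuclideanLin v) - v‖ ^ 2 := by
  have hMN (w : EuclideanSpace ℝ ι) :
      (M * N).toEuclideanLin w = M.toEuclideanLin (N.toEuclideanLin w) := by
    rw [Matrix.toLpLin_mul_same, LinearMap.comp_apply]
  have hfix (u : EuclideanSpace ℝ κ) :
      M.toEuclideanLin u = (M * N).toEuclideanLin (M.toEuclideanLin u) := by
    rw [← LinearMap.comp_apply, ← Matrix.toLpLin_mul_same, h.mul_mul_self]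
  have hadjoint : (M * N).toEuclideanLin.adjoint = (M * N).toEuclideanLin := by
    rw [← Matrix.toEuclideanLin_conjTranspose_eq_adjoint,
      Matrix.conjTranspose_eq_transpose_of_trivial, h.symm_left]
  have horth (u : EuclideanSpace ℝ κ) :
      inner ℝ (M.toEuclideanLin u) (M.toEuclideanLin (N.toEuclideanLin v) - v) = 0 := by
    rw [hfix u, ← LinearMap.adjoint_inner_right, hadjoint, map_sub, ← hfix, hMN, sub_self,
      inner_zero_right]
  have hsplit : M.toEuclideanLin z - v = M.toEuclideanLin (z - N.toEuclideanLin v)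
      + (M.toEuclideanLin (N.toEuclideanLin v) - v) := by rw [map_sub]; abel
  rw [hsplit, sq, sq, sq,
    norm_add_sq_eq_norm_sq_add_norm_sq_of_inner_eq_zero _ _ (horth _)]

theorem toEuclideanLin_eq_of_isLeastSquares (h : IsMoorePenrose M N) {x : EuclideanSpace ℝ κ}
    {v : EuclideanSpace ℝ ι}
    (hx : ∀ z, ‖M.toEuclideanLin x - v‖ ≤ ‖M.toEuclideanLin z - v‖) :
    M.toEuclideanLin x = M.toEuclideanLin (N.toEuclideanLin v) := by
  have hle : ‖M.toEuclideanLin x - v‖ ^ 2 ≤ ‖M.toEuclideanLin (N.toEuclideanLin v) - v‖ ^ 2 := by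
    gcongr
    exact hx _
  rw [h.norm_toEuclideanLin_sub_sq, add_le_iff_nonpos_left, map_sub] at hle
  exact sub_eq_zero.1 <| norm_eq_zero.1 <| pow_eq_zero_iff two_ne_zero |>.1 <|
    le_antisymm hle (sq_nonneg _)

theorem eq_toEuclideanLin_of_isLeastSquares (h : IsMoorePenrose M N) (hNM : N * M = 1)
    {x : EuclideanSpace ℝ κ} {v : EuclideanSpace ℝ ι}
    (hx : ∀ z, ‖M.toEuclideanLin x - v‖ ≤ ‖M.toEuclideanLin z - v‖) :
    x = N.toEuclideanLin v := by
  have hinv (u : EuclideanSpace ℝ κ) : N.toEuclideanLin (M.toEuclideanLin u) = u := by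
    rw [← LinearMap.comp_apply, ← Matrix.toLpLin_mul_same, hNM, Matrix.toLpLin_one,
      LinearMap.id_apply]
  rw [← hinv x, h.toEuclideanLin_eq_of_isLeastSquares hx, hinv]

theorem eq_toEuclideanLin_of_isMinNormLeastSquares (h : IsMoorePenrose M N)
    {x : EuclideanSpace ℝ κ} {v : EuclideanSpace ℝ ι} (hx : IsMinNormLeastSquares M v x) :
    x = N.toEuclideanLin v := by
  have hproj : N.toEuclideanLin (M.toEuclideanLin x) = N.toEuclideanLin v := by
    rw [h.toEuclideanLin_eq_of_isLeastSquares hx.1, ← LinearMap.comp_apply M.toEuclideanLin,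
      ← Matrix.toLpLin_mul_same, ← LinearMap.comp_apply, ← Matrix.toLpLin_mul_same,
      ← Matrix.mul_assoc, h.self_mul_mul]
  have hmin : ‖x‖ ^ 2 ≤ ‖N.toEuclideanLin v‖ ^ 2 := by
    gcongr
    refine hx.2 _ fun w => ?_
    rw [← h.toEuclideanLin_eq_of_isLeastSquares hx.1]
    exact hx.1 w
  have hpyth := h.symm.norm_toEuclideanLin_sub_sq 0 x
  rw [map_zero, zero_sub, zero_sub, norm_neg, map_neg, norm_neg, hproj] at hpyth
  rw [hpyth, add_le_iff_nonpos_right] at hmin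
  exact (sub_eq_zero.1 <| norm_eq_zero.1 <| pow_eq_zero_iff two_ne_zero |>.1 <|
    le_antisymm hmin (sq_nonneg _)).symm

end IsMoorePenrose

end LeastSquares

section Tikhonov

variable {m n p : ℕ} {A : Matrix (Fin m) (Fin n) ℝ} {L : Matrix (Fin p) (Fin n) ℝ} {lam : ℝ}
  {b : EuclideanSpace ℝ (Fin m)}

theorem norm_stackedRhs : ‖stackedRhs p b‖ = ‖b‖ := by
  simp [EuclideanSpace.norm_eq, stackedRhs]

theorem norm_toEuclideanLin_fromRows_sub_stackedRhs_sq (x : EuclideanSpace ℝ (Fin n)) :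
    ‖(Matrix.fromRows A (lam • L)).toEuclideanLin x - stackedRhs p b‖ ^ 2 =
      ‖A.toEuclideanLin x - b‖ ^ 2 + lam ^ 2 * ‖L.toEuclideanLin x‖ ^ 2 := by
  simp [EuclideanSpace.norm_sq_eq, stackedRhs, Matrix.smul_mulVec, mul_pow, Finset.mul_sum]

theorem IsTikhonovSolution.isLeastSquares {x : EuclideanSpace ℝ (Fin n)}
    (hx : IsTikhonovSolution A L lam b x) (z : EuclideanSpace ℝ (Fin n)) :
    ‖(Matrix.fromRows A (lam • L)).toEuclideanLin x - stackedRhs p b‖ ≤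
      ‖(Matrix.fromRows A (lam • L)).toEuclideanLin z - stackedRhs p b‖ := by
  refine le_of_sq_le_sq ?_ (norm_nonneg _)
  simpa only [norm_toEuclideanLin_fromRows_sub_stackedRhs_sq] using hx z

end Tikhonov

section MatrixInjectivity

variable {K ι κ : Type*} [Fintype κ]

theorem rank_eq_card_iff_mulVec_injective [Field K] {M : Matrix ι κ K} :
    M.rank = Fintype.card κ ↔ Function.Injective M.mulVec := by
  have hsum := LinearMap.finrank_range_add_finrank_ker M.mulVecLin
  rw [Module.finrank_fintype_fun_eq_card] at hsum
  rw [← Matrix.coe_mulVecLin, ← LinearMap.ker_eq_bot, ← Submodule.finrank_eq_zero (R := K),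
    Matrix.rank]
  lia

theorem mulVec_injective_of_mul [CommRing K] {μ : Type*} [Fintype μ] {M : Matrix ι κ K}
    {N : Matrix κ μ K} (h : Function.Injective (M * N).mulVec) : Function.Injective N.mulVec := by
  rw [← Matrix.coe_mulVecLin, Matrix.mulVecLin_mul, LinearMap.coe_comp] at h
  exact Function.Injective.of_comp h

theorem mulVec_injective_transpose_mul_self_mul [Field K] [LinearOrder K] [IsStrictOrderedRing K]
    {μ : Type*} [Fintype μ] [Fintype ι] {M : Matrix ι κ K} {N : Matrix κ μ K}
    (h : Function.Injective (M * N).mulVec) : Function.Injective (Mᵀ * (M * N)).mulVec := by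
  rw [← Matrix.coe_mulVecLin, ← LinearMap.ker_eq_bot] at h ⊢
  rw [← Matrix.mul_assoc, Matrix.mulVecLin_mul, LinearMap.ker_comp,
    Matrix.ker_mulVecLin_transpose_mul_self, ← LinearMap.ker_comp, ← Matrix.mulVecLin_mul, h]

theorem exists_matrix_range_mulVecLin_eq {n : Type*} [Finite n] [Field K]
    (S : Submodule K (n → K)) :
    ∃ W : Matrix n (Fin (Module.finrank K S)) K,
      Function.Injective W.mulVec ∧ LinearMap.range W.mulVecLin = S := by
  set f := S.subtype ∘ₗ (Module.finBasis K S).equivFun.symm.toLinearMap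
  have hf : (LinearMap.toMatrix' f).mulVecLin = f := Matrix.toLin'_toMatrix' f
  refine ⟨LinearMap.toMatrix' f, ?_, ?_⟩
  · rw [← Matrix.coe_mulVecLin, hf]
    exact S.injective_subtype.comp (LinearEquiv.injective _)
  · rw [hf, LinearEquiv.range_comp, Submodule.range_subtype]

theorem mulVec_injective_fromRows_iff [CommRing K] {ι' : Type*} {A : Matrix ι κ K}
    {B : Matrix ι' κ K} :
    Function.Injective (Matrix.fromRows A B).mulVec ↔ ∀ x, A *ᵥ x = 0 → B *ᵥ x = 0 → x = 0 := by
  rw [← Matrix.coe_mulVecLin, injective_iff_map_eq_zero]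
  simp only [Matrix.mulVecLin_apply, Matrix.fromRows_mulVec, ← Sum.elim_zero_zero,
    Sum.elim_eq_iff, and_imp]

theorem pinv_mul_self_eq_one [Fintype ι] [DecidableEq κ] {M : Matrix ι κ ℝ}
    (hM : M.rank = Fintype.card κ) : pinv M * M = 1 :=
  (isMoorePenrose_pinv M).mul_eq_one_of_injective (rank_eq_card_iff_mulVec_injective.1 hM)

end MatrixInjectivity

section GrassmanPair

variable {m n p : ℕ} {A : Matrix (Fin m) (Fin n) ℝ} {L : Matrix (Fin p) (Fin n) ℝ}

theorem isGMP_iff_mulVec_injective :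
    IsGMP A L ↔ Function.Injective (Matrix.fromRows A L).mulVec := by
  rw [IsGMP, ← rank_eq_card_iff_mulVec_injective, Fintype.card_fin]

theorem isGMP_iff : IsGMP A L ↔ ∀ x, A *ᵥ x = 0 → L *ᵥ x = 0 → x = 0 :=
  isGMP_iff_mulVec_injective.trans mulVec_injective_fromRows_iff

theorem isGMP_smul_right_iff {c : ℝ} (hc : c ≠ 0) : IsGMP A (c • L) ↔ IsGMP A L := by
  simp only [isGMP_iff, Matrix.smul_mulVec, smul_eq_zero_iff_right hc]

theorem isGMP_iff_mulVec_injective_mul {ν : Type*} [Fintype ν] {W : Matrix (Fin n) ν ℝ}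
    (hW : Function.Injective W.mulVec)
    (hWL : LinearMap.range W.mulVecLin = LinearMap.ker L.mulVecLin) :
    IsGMP A L ↔ Function.Injective (A * W).mulVec := by
  rw [isGMP_iff, ← Matrix.coe_mulVecLin (A * W), injective_iff_map_eq_zero, Matrix.mulVecLin_mul]
  constructor
  · intro h y hy
    refine hW ((h _ hy ?_).trans (Matrix.mulVec_zero W).symm)
    exact LinearMap.mem_ker.1 (hWL ▸ LinearMap.mem_range_self W.mulVecLin y)
  · intro h x hAx hLx
    obtain ⟨y, rfl⟩ : x ∈ LinearMap.range W.mulVecLin := hWL ▸ LinearMap.mem_ker.2 hLx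
    rw [h y hAx, map_zero]

end GrassmanPair

section RandomSketch

theorem pi_cond {ι : Type*} [Fintype ι] {α : ι → Type*} [∀ i, MeasurableSpace (α i)]
    (μ : ∀ i, Measure (α i)) [∀ i, SigmaFinite (μ i)] {s : ∀ i, Set (α i)}
    (hs : ∀ i, μ i (s i) ≠ ⊤) :
    Measure.pi (fun i => (μ i)[|s i]) = (Measure.pi μ)[|Set.univ.pi s] := by
  refine Measure.pi_eq fun t _ => ?_
  rw [ProbabilityTheory.cond, Measure.smul_apply, Measure.restrict_pi_pi, Measure.pi_pi,
    Measure.pi_pi, smul_eq_mul, ENNReal.prod_inv_distrib fun i _ j _ _ => .inr (hs j),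
    ← Finset.prod_mul_distrib]
  rfl

theorem uniformMatrixLaw_absolutelyContinuous (N ℓ : ℕ) :
    uniformMatrixLaw N ℓ ≪ (volume : Measure (Fin N → Fin ℓ → ℝ)) := by
  have hfin : volume (Set.Icc (-√3) √3) ≠ ⊤ := measure_Icc_lt_top.ne
  rw [uniformMatrixLaw, pi_cond _ fun _ => hfin, pi_cond]
  · exact cond_absolutelyContinuous
  · intro _
    rw [Measure.pi_pi]
    exact ENNReal.prod_ne_top fun _ _ => hfin

theorem finite_setOf_det_add_smul_eq_zero {K ι : Type*} [Field K] [Fintype ι] [DecidableEq ι]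
    (A : Matrix ι ι K) {B : Matrix ι ι K} (hB : B.det ≠ 0) :
    {t : K | (A + t • B).det = 0}.Finite := by
  set q := ((Polynomial.X : Polynomial K) • B.map Polynomial.C + A.map Polynomial.C).det with hq
  have hq0 : q ≠ 0 := fun h => hB <| by
    rw [← Polynomial.coeff_det_X_add_C_card B A, ← hq, h, Polynomial.coeff_zero]
  have heval (t : K) : q.eval t = (A + t • B).det := by
    rw [hq, ← Polynomial.coe_evalRingHom, RingHom.map_det]
    congr 1
    ext i j
    simp [add_comm, mul_comm t]
  simpa only [Polynomial.IsRoot, heval] using Polynomial.finite_setOfPred_isRoot hq0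

theorem ae_det_ne_zero {E ι : Type*} [NormedAddCommGroup E] [NormedSpace ℝ E]
    [FiniteDimensional ℝ E] [MeasurableSpace E] [BorelSpace E] (μ : Measure E)
    [μ.IsAddHaarMeasure] [Fintype ι] [DecidableEq ι] (D : E →ₗ[ℝ] Matrix ι ι ℝ) {x₀ : E}
    (hx₀ : (D x₀).det ≠ 0) : ∀ᵐ x ∂μ, (D x).det ≠ 0 := by
  have hclosed : IsClosed {x | (D x).det = 0} :=
    isClosed_eq D.continuous_of_finiteDimensional.matrix_det continuous_const
  refine ae_mem_of_ae_add_linearMap_mem (LinearMap.toSpanSingleton ℝ E x₀) volume μ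
    hclosed.measurableSet.compl fun y => ?_
  have hfinite := finite_setOf_det_add_smul_eq_zero (D y) hx₀
  filter_upwards [hfinite.countable.ae_notMem volume] with t ht
  change (D (y + t • x₀)).det ≠ 0
  rwa [map_add, map_smul]

theorem ae_uniformMatrixLaw_mulVec_injective {N r : ℕ} {G : Matrix (Fin N) (Fin r) ℝ}
    (hG : Function.Injective G.mulVec) :
    ∀ᵐ Ω ∂(uniformMatrixLaw N N), ∀ (ℓ : ℕ) (h : ℓ ≤ N), r ≤ ℓ →
      Function.Injective (((Matrix.of Ω).submatrix id (Fin.castLE h))ᵀ * G).mulVec := by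
  have hr : r ≤ N := by
    simpa using LinearMap.finrank_le_finrank_of_injective (f := G.mulVecLin) hG
  let D : (Fin N → Fin N → ℝ) →ₗ[ℝ] Matrix (Fin r) (Fin r) ℝ :=
    { toFun Ω := ((Matrix.of Ω).submatrix id (Fin.castLE hr))ᵀ * G
      map_add' Ω Ω' := Matrix.add_mul _ _ G
      map_smul' t Ω := Matrix.smul_mul t _ G }
  have hwitness : (D fun i j => if h : (j : ℕ) < r then G i ⟨j, h⟩ else 0).det ≠ 0 := by
    have hD : (D fun i j => if h : (j : ℕ) < r then G i ⟨j, h⟩ else 0) = Gᵀ * G := by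
      ext i j
      simp [D, Matrix.mul_apply]
    rw [hD, ← isUnit_iff_ne_zero, ← Matrix.isUnit_iff_isUnit_det,
      ← Matrix.mulVec_injective_iff_isUnit]
    have hG1 : Function.Injective (G * (1 : Matrix (Fin r) (Fin r) ℝ)).mulVec := by
      rwa [Matrix.mul_one]
    simpa only [Matrix.mul_one] using mulVec_injective_transpose_mul_self_mul hG1
  filter_upwards [(uniformMatrixLaw_absolutelyContinuous N N).ae_le
    (ae_det_ne_zero volume D hwitness)] with Ω hΩ ℓ h hrℓ x y hxy
  refine Matrix.mulVec_injective_of_det_ne_zero hΩ ?_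
  ext i
  simpa [D, Matrix.mulVec, dotProduct, Matrix.mul_apply] using congrFun hxy (Fin.castLE hrℓ i)

theorem ae_isRangeFinderOutput_mulVec_injective {M N r : ℕ} {B : Matrix (Fin M) (Fin N) ℝ}
    {C : Matrix (Fin M) (Fin r) ℝ} (hBC : Function.Injective (Bᵀ * C).mulVec) (ε : ℝ) :
    ∀ᵐ Ω ∂(uniformMatrixLaw N N), ∀ (ℓ : ℕ) (Q : Matrix (Fin M) (Fin ℓ) ℝ),
      IsRangeFinderOutput B ε Ω Q → r ≤ ℓ → Function.Injective (Qᵀ * C).mulVec := by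
  filter_upwards [ae_uniformMatrixLaw_mulVec_injective hBC] with Ω hΩ ℓ Q hQ hrℓ
  obtain ⟨-, ⟨hℓ, R, -, -, hR⟩, -⟩ := hQ
  refine mulVec_injective_of_mul (M := Rᵀ) ?_
  rw [← Matrix.mul_assoc, ← Matrix.transpose_mul, ← hR, Matrix.transpose_mul, Matrix.mul_assoc]
  exact hΩ ℓ hℓ hrℓ

theorem ae_isGMP_proj {m n p : ℕ} {A : Matrix (Fin m) (Fin n) ℝ} {L : Matrix (Fin p) (Fin n) ℝ}
    (hAL : IsGMP A L) (ε : ℝ) :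
    ∀ᵐ ΩQ ∂(uniformMatrixLaw m m),
    ∀ (ℓ₁ : ℕ) (Q : Matrix (Fin n) (Fin ℓ₁) ℝ), IsRangeFinderOutput Aᵀ ε ΩQ Q →
    ∀ᵐ ΩP ∂(uniformMatrixLaw ℓ₁ ℓ₁),
    ∀ (ℓ₂ : ℕ) (P : Matrix (Fin m) (Fin ℓ₂) ℝ), IsRangeFinderOutput (A * Q) ε ΩP P →
      n ≤ ℓ₂ + L.rank → IsGMP (P * Pᵀ * A) L := by
  obtain ⟨W, hW, hWL⟩ := exists_matrix_range_mulVecLin_eq (LinearMap.ker L.mulVecLin)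
  have hrank : L.rank + Module.finrank ℝ (LinearMap.ker L.mulVecLin) = n :=
    L.mulVecLin.finrank_range_add_finrank_ker.trans (Module.finrank_fin_fun ℝ)
  have hAW : Function.Injective (A * W).mulVec := (isGMP_iff_mulVec_injective_mul hW hWL).1 hAL
  have hAAAW : Function.Injective (Aᵀᵀ * (Aᵀ * (A * W))).mulVec :=
    mulVec_injective_transpose_mul_self_mul (mulVec_injective_transpose_mul_self_mul hAW)
  filter_upwards [ae_isRangeFinderOutput_mulVec_injective hAAAW ε] with ΩQ hΩQ ℓ₁ Q hQ
  rcases lt_or_ge ℓ₁ (Module.finrank ℝ (LinearMap.ker L.mulVecLin)) with hlt | hge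
  · refine .of_forall fun ΩP ℓ₂ P hP hn => ?_
    obtain ⟨-, ⟨hℓ, -⟩, -⟩ := hP
    lia
  have hAQAW : Function.Injective ((A * Q)ᵀ * (A * W)).mulVec := by
    rw [Matrix.transpose_mul, Matrix.mul_assoc]
    exact hΩQ ℓ₁ Q hQ hge
  filter_upwards [ae_isRangeFinderOutput_mulVec_injective hAQAW ε] with ΩP hΩP ℓ₂ P hP hn
  rw [isGMP_iff_mulVec_injective_mul hW hWL]
  refine mulVec_injective_of_mul (M := Pᵀ) ?_
  rw [Matrix.mul_assoc, Matrix.mul_assoc, ← Matrix.mul_assoc Pᵀ, hP.1, Matrix.one_mul]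
  exact hΩP ℓ₂ P hP (by lia)

end RandomSketch

section TwoSidedSketch

theorem fromRows_sub_fromRows {R ι ι' κ : Type*} [Sub R] (A A' : Matrix ι κ R)
    (B B' : Matrix ι' κ R) :
    Matrix.fromRows A B - Matrix.fromRows A' B' = Matrix.fromRows (A - A') (B - B') := by
  ext (i | i) j <;> rfl

variable {m n p ℓ₁ ℓ₂ : ℕ} {A : Matrix (Fin m) (Fin n) ℝ} {L : Matrix (Fin p) (Fin n) ℝ}
  {Q : Matrix (Fin n) (Fin ℓ₁) ℝ} {P : Matrix (Fin m) (Fin ℓ₂) ℝ} {ε lam : ℝ}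
  {ΩQ : Fin m → Fin m → ℝ} {ΩP : Fin ℓ₁ → Fin ℓ₁ → ℝ}

namespace IsRangeFinderOutput

theorem norm_fromRows_sub_mul_le (hQ : IsRangeFinderOutput Aᵀ ε ΩQ Q) (hlam : 0 ≤ lam) :
    ‖Matrix.fromRows A (lam • L) - Matrix.fromRows A (lam • L) * (Q * Qᵀ)‖ ≤
      ε + lam * ‖L * (Q * Qᵀ - 1)‖ := by
  have hA : ‖A - A * (Q * Qᵀ)‖ ≤ ε := by
    rw [← Matrix.l2_opNorm_conjTranspose, Matrix.conjTranspose_eq_transpose_of_trivial]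
    simpa [Matrix.mul_assoc] using hQ.2.2
  have hL : ‖lam • L - lam • L * (Q * Qᵀ)‖ = lam * ‖L * (Q * Qᵀ - 1)‖ := by
    rw [Matrix.smul_mul, ← smul_sub, norm_smul_of_nonneg hlam, Matrix.mul_sub, Matrix.mul_one,
      norm_sub_rev]
  rw [Matrix.fromRows_mul, fromRows_sub_fromRows, ← hL]
  exact (norm_fromRows_le _ _).trans (by gcongr)

theorem norm_fromRows_mul_sub_le (hQ : Qᵀ * Q = 1) (hP : IsRangeFinderOutput (A * Q) ε ΩP P) :
    ‖Matrix.fromRows (P * Pᵀ * A) L * (Q * Qᵀ) - Matrix.fromRows A L * (Q * Qᵀ)‖ ≤ ε := by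
  have hQt : ‖Qᵀ‖ ≤ 1 := by
    rw [← Matrix.conjTranspose_eq_transpose_of_trivial, Matrix.l2_opNorm_conjTranspose]
    refine norm_le_one_of_conjTranspose_mul_self_eq_one ?_
    rwa [Matrix.conjTranspose_eq_transpose_of_trivial]
  have hfactor : P * Pᵀ * A * (Q * Qᵀ) - A * (Q * Qᵀ) = (P * Pᵀ * (A * Q) - A * Q) * Qᵀ := by
    simp only [Matrix.sub_mul, Matrix.mul_assoc]
  rw [Matrix.fromRows_mul, Matrix.fromRows_mul, fromRows_sub_fromRows, sub_self, hfactor]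
  calc _ ≤ ‖(P * Pᵀ * (A * Q) - A * Q) * Qᵀ‖ + ‖(0 : Matrix (Fin p) (Fin n) ℝ)‖ :=
        norm_fromRows_le _ _
    _ ≤ ‖A * Q - P * Pᵀ * (A * Q)‖ * ‖Qᵀ‖ := by
        rw [norm_zero, add_zero, norm_sub_rev]
        exact Matrix.l2_opNorm_mul _ _
    _ ≤ ε := (mul_le_of_le_one_right (norm_nonneg _) hQt).trans hP.2.2

theorem norm_pinv_sub_pinv_le (hAL : IsGMP A L) (hlam : 0 < lam)
    (hQ : IsRangeFinderOutput Aᵀ ε ΩQ Q) (hP : IsRangeFinderOutput (A * Q) ε ΩP P) :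
    let 𝒜 := Matrix.fromRows A (lam • L)
    let 𝒜R := Matrix.fromRows (P * Pᵀ * A) (lam • L) * (Q * Qᵀ)
    ‖pinv 𝒜R - pinv 𝒜‖ ≤
      √2 * ‖pinv 𝒜‖ * (‖pinv 𝒜R‖ * ε + ‖pinv 𝒜‖ * (ε + lam * ‖L * (Q * Qᵀ - 1)‖)) := by
  intro 𝒜 𝒜R
  have hproj := isStarProjection_mul_transpose hQ.1
  have hinv : pinv 𝒜 * 𝒜 = 1 :=
    pinv_mul_self_eq_one (((isGMP_smul_right_iff hlam.ne').2 hAL).trans (Fintype.card_fin n).symm)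
  have hRproj : 𝒜R * (Q * Qᵀ) = 𝒜R := by rw [Matrix.mul_assoc, hproj.isIdempotentElem.eq]
  exact (isMoorePenrose_pinv 𝒜).norm_sub_le_of_mul_projection (isMoorePenrose_pinv 𝒜R) hinv hproj
    hRproj (hP.norm_fromRows_mul_sub_le hQ.1) (hQ.norm_fromRows_sub_mul_le hlam.le)
    (le_add_of_nonneg_right (by positivity))

theorem norm_sub_tikhonov_le (hAL : IsGMP A L) (hlam : 0 < lam)
    (hQ : IsRangeFinderOutput Aᵀ ε ΩQ Q) (hP : IsRangeFinderOutput (A * Q) ε ΩP P)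
    {b : EuclideanSpace ℝ (Fin m)} {x y : EuclideanSpace ℝ (Fin n)}
    (hx : IsTikhonovSolution A L lam b x) :
    let 𝒜 := Matrix.fromRows A (lam • L)
    let 𝒜R := Matrix.fromRows (P * Pᵀ * A) (lam • L) * (Q * Qᵀ)
    IsMinNormLeastSquares 𝒜R (stackedRhs p b) y →
    ‖y - x‖ ≤ √2 * ‖pinv 𝒜‖ *
      (‖pinv 𝒜R‖ * ε + ‖pinv 𝒜‖ * (ε + lam * ‖L * (Q * Qᵀ - 1)‖)) * ‖b‖ := by
  intro 𝒜 𝒜R hy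
  have hinv : pinv 𝒜 * 𝒜 = 1 :=
    pinv_mul_self_eq_one (((isGMP_smul_right_iff hlam.ne').2 hAL).trans (Fintype.card_fin n).symm)
  have hsub : y - x = (pinv 𝒜R - pinv 𝒜).toEuclideanLin (stackedRhs p b) := by
    rw [(isMoorePenrose_pinv 𝒜R).eq_toEuclideanLin_of_isMinNormLeastSquares hy,
      (isMoorePenrose_pinv 𝒜).eq_toEuclideanLin_of_isLeastSquares hinv hx.isLeastSquares,
      map_sub, LinearMap.sub_apply]
  calc ‖y - x‖ ≤ ‖pinv 𝒜R - pinv 𝒜‖ * ‖stackedRhs p b‖ := by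
        rw [hsub]
        exact norm_toEuclideanLin_le _ _
    _ ≤ _ := by
        rw [norm_stackedRhs]
        exact mul_le_mul_of_nonneg_right (norm_pinv_sub_pinv_le hAL hlam hQ hP) (norm_nonneg b)

end IsRangeFinderOutput

end TwoSidedSketch

theorem sqrt_two_le_goldenRatio : √2 ≤ Real.goldenRatio := by
  rw [Real.sqrt_le_left Real.goldenRatio_pos.le, Real.goldenRatio_sq]
  linarith [Real.one_lt_goldenRatio]

theorem relative_error_le_of_error_le {a b x e ε lam ξ γ c₁ c₂ K₁ K₂ r s : ℝ} (ha : 0 ≤ a)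
    (hb : 0 ≤ b) (hx : 0 ≤ x) (hγ : 0 ≤ γ) (hε : 0 ≤ ε) (hlam : 0 ≤ lam) (hξ : 0 ≤ ξ)
    (hr : 0 ≤ r) (hs : 0 ≤ s) (he : e ≤ √2 * a * (ξ * ε + a * (ε + lam * γ)) * b)
    (hεs : ε ≤ c₁ * s + K₁ * s ^ 2) (hlams : lam ≤ c₂ * s + K₂ * s ^ 2) :
    e / x ≤
      a * ((1 + √5) / 2 * c₁ * (ξ * (b / x) + a * (b / x))
        + (1 + √5) / 2 * c₂ * γ * (a * (b / x)) + r) * s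
      + a * ((1 + √5) / 2 * K₁ * (ξ * (b / x) + a * (b / x))
        + (1 + √5) / 2 * K₂ * γ * (a * (b / x))) * s ^ 2 := by
  calc e / x ≤ √2 * a * (ξ * ε + a * (ε + lam * γ)) * b / x := by gcongr
    _ ≤ (1 + √5) / 2 * a * (ξ * (c₁ * s + K₁ * s ^ 2)
          + a * (c₁ * s + K₁ * s ^ 2 + (c₂ * s + K₂ * s ^ 2) * γ)) * b / x := by
        gcongr
        exact sqrt_two_le_goldenRatio
    _ ≤ (1 + √5) / 2 * a * (ξ * (c₁ * s + K₁ * s ^ 2)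
          + a * (c₁ * s + K₁ * s ^ 2 + (c₂ * s + K₂ * s ^ 2) * γ)) * b / x + a * r * s :=
        le_add_of_nonneg_right (by positivity)
    _ = _ := by ring

theorem mainTheorem3_general {m n p : ℕ} {A : Matrix (Fin m) (Fin n) ℝ}
    {L : Matrix (Fin p) (Fin n) ℝ} (hAL : IsGMP A L) {b : EuclideanSpace ℝ (Fin m)} (ε : ℝ)
    {lam : ℝ} (hlam : 0 < lam) {xlam : EuclideanSpace ℝ (Fin n)}
    (hxlam : IsTikhonovSolution A L lam b xlam) :
    ∀ᵐ ΩQ ∂(uniformMatrixLaw m m),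
    ∀ (ℓ₁ : ℕ) (Q : Matrix (Fin n) (Fin ℓ₁) ℝ), IsRangeFinderOutput Aᵀ ε ΩQ Q →
    ∀ᵐ ΩP ∂(uniformMatrixLaw ℓ₁ ℓ₁),
    ∀ (ℓ₂ : ℕ) (P : Matrix (Fin m) (Fin ℓ₂) ℝ), IsRangeFinderOutput (A * Q) ε ΩP P →
    let 𝒜 := Matrix.fromRows A (lam • L)
    let 𝒜P := Matrix.fromRows (P * Pᵀ * A) (lam • L)
    let 𝒜R := Matrix.fromRows (P * Pᵀ * A * (Q * Qᵀ)) (lam • (L * (Q * Qᵀ)))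
    (n ≤ ℓ₂ + L.rank → 𝒜P.rank = n) ∧
    ∀ ξ : ℝ, (ξ = ‖pinv 𝒜R‖ ∨ (𝒜P.rank = n ∧ ξ = ‖pinv 𝒜P‖)) →
    ∀ xR : EuclideanSpace ℝ (Fin n), IsMinNormLeastSquares 𝒜R (stackedRhs p b) xR →
      ‖xR - xlam‖ ≤ √2 * ‖pinv 𝒜‖ *
        (ξ * ε + ‖pinv 𝒜‖ * (ε + lam * ‖L * (Q * Qᵀ - 1)‖)) * ‖b‖ := by
  filter_upwards [ae_isGMP_proj hAL ε] with ΩQ hΩQ ℓ₁ Q hQ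
  filter_upwards [hΩQ ℓ₁ Q hQ] with ΩP hΩP ℓ₂ P hP
  intro 𝒜 𝒜P 𝒜R
  have h𝒜R : 𝒜P * (Q * Qᵀ) = 𝒜R := by rw [Matrix.fromRows_mul, Matrix.smul_mul]
  refine ⟨fun hn => (isGMP_smul_right_iff hlam.ne').2 (hΩP ℓ₂ P hP hn), fun ξ hξ xR hxR => ?_⟩
  have hpinv : ‖pinv 𝒜R‖ ≤ ξ := by
    rcases hξ with rfl | ⟨hrank, rfl⟩
    · exact le_rfl
    · rw [← h𝒜R]
      exact (isMoorePenrose_pinv _).norm_le_of_mul_projection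
        (pinv_mul_self_eq_one (hrank.trans (Fintype.card_fin n).symm))
        (isStarProjection_mul_transpose hQ.1)
  have hε : 0 ≤ ε := (norm_nonneg _).trans hQ.2.2
  have herror := hQ.norm_sub_tikhonov_le hAL hlam hP hxlam (h𝒜R ▸ hxR)
  rw [h𝒜R] at herror
  exact herror.trans (by gcongr)

theorem mainTheorem3 {m n p : ℕ} (hmn : m ≤ n)
    (A : Matrix (Fin m) (Fin n) ℝ) (L : Matrix (Fin p) (Fin n) ℝ) (hAL : IsGMP A L)
    (b : EuclideanSpace ℝ (Fin m))
    (k : ℕ) (hk : k < m)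
    (ε lam : ℝ) (hε : 0 < ε) (hlam : 0 < lam)
    (c₁ c₂ K₁ K₂ : ℝ)
    (hεσ : |ε - c₁ * sval A k| ≤ K₁ * sval A k ^ 2)
    (hlamσ : |lam - c₂ * sval A k| ≤ K₂ * sval A k ^ 2)
    (U : Matrix (Fin m) (Fin m) ℝ) (V : Matrix (Fin p) (Fin p) ℝ) (X : Matrix (Fin n) (Fin n) ℝ)
    (α β : Fin n → ℝ) (hX : IsGSVD A L U V X α β)
    (xlam : EuclideanSpace ℝ (Fin n)) (hxlam : IsTikhonovSolution A L lam b xlam)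
    (hx0 : xlam ≠ 0) :
    ∀ᵐ ΩQ ∂(uniformMatrixLaw m m),
    ∀ (ℓ₁ : ℕ) (Q : Matrix (Fin n) (Fin ℓ₁) ℝ), IsRangeFinderOutput Aᵀ ε ΩQ Q →
    ∀ᵐ ΩP ∂(uniformMatrixLaw ℓ₁ ℓ₁),
    ∀ (ℓ₂ : ℕ) (P : Matrix (Fin m) (Fin ℓ₂) ℝ), IsRangeFinderOutput (A * Q) ε ΩP P →
    let 𝒜 := Matrix.fromRows A (lam • L)
    let 𝒜P := Matrix.fromRows (P * Pᵀ * A) (lam • L)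
    let 𝒜R := Matrix.fromRows (P * Pᵀ * A * (Q * Qᵀ)) (lam • (L * (Q * Qᵀ)))
    let c := (1 + √5) / 2
    let νt := ‖b‖ / ‖xlam‖
    let ν := ‖pinv 𝒜‖ * νt
    let κ := ‖𝒜‖ * ‖pinv 𝒜‖
    let γ₁ := ‖L * (Q * Qᵀ - 1)‖
    let γ₂ := ‖X⁻¹‖ * √(‖X‖ ^ 2 + c₂ ^ 2)
    let σ := sval A k
    (n ≤ ℓ₂ + L.rank → 𝒜P.rank = n) ∧
    ∀ ξ : ℝ, (ξ = ‖pinv 𝒜R‖ ∨ (𝒜P.rank = n ∧ ξ = ‖pinv 𝒜P‖)) →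
    ∀ xR : EuclideanSpace ℝ (Fin n), IsMinNormLeastSquares 𝒜R (stackedRhs p b) xR →
      ‖xR - xlam‖ / ‖xlam‖ ≤
        ‖pinv 𝒜‖ * (c * c₁ * (ξ * νt + ν) + c * c₂ * γ₁ * ν + (1 + c * κ * ν) * γ₂) * σ
        + ‖pinv 𝒜‖ * (c * K₁ * (ξ * νt + ν) + c * K₂ * γ₁ * ν) * σ ^ 2 := by
  refine (mainTheorem3_general hAL ε hlam hxlam).mono fun ΩQ hΩQ ℓ₁ Q hQ =>
    (hΩQ ℓ₁ Q hQ).mono fun ΩP hΩP ℓ₂ P hP => (hΩP ℓ₂ P hP).imp_right fun hbound ξ hξ xR hxR => ?_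
  have hσ : 0 ≤ sval A k := LinearMap.singularValues_nonneg _ k
  have hξ0 : 0 ≤ ξ := by rcases hξ with rfl | ⟨-, rfl⟩ <;> exact norm_nonneg _
  exact relative_error_le_of_error_le (norm_nonneg _) (norm_nonneg _) (norm_nonneg _)
    (norm_nonneg _) hε.le hlam.le hξ0 (by positivity) hσ (hbound ξ hξ xR hxR)
    (by linarith [(abs_le.1 hεσ).2]) (by linarith [(abs_le.1 hlamσ).2])
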